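/- Conventions. In a complete lattice $Q$, say that $a$ is totally above $b$, written $a\succ b$, if every $S\subseteq Q$ with $\bigwedge S\le b$ contains some $s\le a$. A value quantale is a complete lattice $Q$ with a commutative monoid structure $(Q,+,0)$ such that $0$ is the least element, $x+\bigwedge_{j} y_j=\bigwedge_{j}(x+y_j)$ for all families, $a=\bigwedge\{x: x\succ a\}$ for every $a\in Q$, and $a\wedge b\succ 0$ whenever $a,b\succ 0$. A $Q$-metric space is a set $X$ with $d:X\times X\to Q$ satisfying $d(x,y)=0\Leftrightarrow x=y$, $d(x,y)=d(y,x)$ and $d(x,z)\le d(x,y)+d(y,z)$; together with the nonexpanding maps these form the category $Q\text{-}\mathbf{Met}$, which is symmetric monoidal closed with $X\otimes Y=X\times Y$ carrying the sum distance and $[X,Y]$ the set of nonexpanding maps with the supremum distance. A nonexpanding map $e:X\to Y$ is dense if for all $y\in Y$ and $q\succ 0$ there is $x\in X$ with $q\succ d(ex,y)$. Let $\mathcal E$ be the class of dense maps; with $\mathcal M$ the class of closed isometries, $(\mathcal E,\mathcal M)$ is a factorization system, the factorization of a map being through the closure of its image. For $q\neq 0$ let $2_q$ be the space with two points at distance $q$.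 Let $\mathcal K$ be a category enriched over $Q\text{-}\mathbf{Met}$ and $\lambda$ a regular cardinal. An object $A$ of $\mathcal K$ is $\lambda$-presentable if $\mathcal K(A,-):\mathcal K\to Q\text{-}\mathbf{Met}$ preserves $\lambda$-filtered colimits. $\mathcal K$ is locally $\lambda$-presentable if it has all small conical colimits and all copowers by objects of $Q\text{-}\mathbf{Met}$, its $\lambda$-presentable objects form an essentially small full subcategory, and every object is a $\lambda$-filtered colimit of $\lambda$-presentable objects. Let $f:K\to L$ be a morphism of $\mathcal K$. For $g:A\to B$ in $\mathcal K$: * let $\mathcal K(B,L)\to\mathcal P(g,L)\to\mathcal K(A,L)$ be the $(\mathcal E,\mathcal M)$-factorization of $\mathcal K(g,L)$, let $\mathcal P(g,f)$ be the pullback of $\mathcal P(g,L)\to\mathcal K(A,L)$ along $\mathcal K(A,f)$, and let $r:\mathcal K(B,K)\to\mathcal P(g,f)$ be the map induced by $\mathcal K(g,K)$ and by $\mathcal K(B,K)\to\mathcal K(B,L)\to\mathcal P(g,L)$; * let $\mathcal K^{\to}(g,f)$ be the pullback of $\mathcal K(g,L)$ and $\mathcal K(A,f)$, i.e. the space of commutative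 squares $(u,v)$ with $fu=vg$, let $\mathcal K^{\to}(g,f)\to\mathcal Q(g,f)\to\mathcal K(A,K)$ be the $(\mathcal E,\mathcal M)$-factorization of the projection $(u,v)\mapsto u$, and let $\bar q:\mathcal K(B,K)\to\mathcal Q(g,f)$ be the composite of $t\mapsto(tg,ft)$ with $\mathcal K^{\to}(g,f)\to\mathcal Q(g,f)$. The morphism $f$ is $(\lambda,\mathcal E)$-pure if $r\in\mathcal E$ for every $g:A\to B$ with $A$ and $B$ $\lambda$-presentable. It is barely $(\lambda,\mathcal E)$-pure if $\bar q\in\mathcal E$ for every such $g$. It is weakly $(\lambda,\mathcal E)$-pure if for every $q\succ 0$, every such $g$, and all $u:A\to K$, $v:B\to L$ with $d(fu,vg)\le q$, there is $t:B\to K$ with $d(tg,u)\le q+q$. **Proposition.** Let $Q$ be a value quantale and let $\lambda$ be a regular cardinal such that for every $q\succ 0$ with $q\ne 0$ the space $2_q$ is $\lambda$-presentable in $Q\text{-}\mathbf{Met}$ (this holds, for example, whenever $\lambda>|Q|$, and for every uncountable $\lambda$ when $Q=[0,\infty]$). Let $\mathcal K$ be a locally $\lambda$-presentable category enriched over $Q\text{-}\mathbf{Met}$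 and let $f:K\to L$ be a morphism of $\mathcal K$. The following are equivalent: 1. $f$ is weakly $(\lambda,\mathcal E)$-pure; 2. $f$ is $(\lambda,\mathcal E)$-pure; 3. $f$ is barely $(\lambda,\mathcal E)$-pure. -/

import Mathlib

open CategoryTheory CategoryTheory.Limits Opposite

universe w v u

/-! ## Value quantales -/

/-- `a` is totally above `b`: every set whose infimum is below `b` has a member below `a`. -/
def TotallyAbove {Q : Type w} [CompleteLattice Q] (a b : Q) : Prop :=
  ∀ S : Set Q, sInf S ≤ b → ∃ s ∈ S, s ≤ a

/-- A value quantale: a complete lattice with a commutative monoid structure whose unit is the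
least element, such that addition distributes over all infima, every element is the infimum of
the elements totally above it, and the elements totally above `0` are closed under binary meets. -/
class ValueQuantale (Q : Type w) extends CompleteLattice Q, AddCommMonoid Q where
  zero_eq_bot : (0 : Q) = ⊥
  add_sInf : ∀ (x : Q) (S : Set Q), x + sInf S = sInf ((fun y => x + y) '' S)
  sInf_totallyAbove : ∀ a : Q, sInf {x : Q | TotallyAbove x a} = a
  inf_totallyAbove : ∀ a b : Q, TotallyAbove a 0 → TotallyAbove b 0 → TotallyAbove (a ⊓ b) 0

namespace ValueQuantale

variable {Q : Type w} [ValueQuantale Q]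

theorem zero_le' (a : Q) : 0 ≤ a := by
  rw [zero_eq_bot]; exact bot_le

theorem add_le_add_left' (x : Q) {a b : Q} (h : a ≤ b) : x + a ≤ x + b := by
  have h1 := add_sInf x {a, b}
  rw [Set.image_pair, sInf_pair, sInf_pair, inf_eq_left.2 h] at h1
  rw [h1]; exact inf_le_right

theorem add_le_add' {a b c d : Q} (h : a ≤ b) (h' : c ≤ d) : a + c ≤ b + d := by
  refine (add_le_add_left' a h').trans ?_
  rw [add_comm a d, add_comm b d]
  exact add_le_add_left' d h

theorem le_add_right' (a b : Q) : a ≤ a + b := by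
  simpa using add_le_add_left' a (zero_le' b)

theorem le_of_totallyAbove {a b : Q} (h : TotallyAbove a b) : b ≤ a := by
  obtain ⟨s, hs, hsa⟩ := h {b} (by simp)
  rw [Set.mem_singleton_iff] at hs
  exact hs ▸ hsa

theorem totallyAbove_mono {a b c : Q} (h : TotallyAbove a b) (hc : c ≤ b) : TotallyAbove a c :=
  fun S hS => h S (hS.trans hc)

/-- Every `q ≻ 0` admits `p ≻ 0` with `q ≻ p + p`. -/
theorem exists_half {q : Q} (hq : TotallyAbove q 0) :
    ∃ p : Q, TotallyAbove p 0 ∧ TotallyAbove q (p + p) := by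
  have interp : ∃ x : Q, TotallyAbove q x ∧ TotallyAbove x 0 := by
    obtain ⟨z, ⟨x, hx, hzx⟩, hzq⟩ := hq {z : Q | ∃ x : Q, TotallyAbove x 0 ∧ TotallyAbove z x} (by
      refine le_trans ?_ (sInf_totallyAbove (0 : Q)).le
      refine le_sInf fun x hx => ?_
      refine le_trans ?_ (sInf_totallyAbove x).le
      exact sInf_le_sInf fun z hz => ⟨x, hx, hz⟩)
    exact ⟨x, fun S hS => (hzx S hS).imp fun s hs => ⟨hs.1, hs.2.trans hzq⟩, hx⟩
  obtain ⟨x, hqx, hx⟩ := interp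
  obtain ⟨_, ⟨a, b, ha, hb, rfl⟩, hab⟩ :=
    hx {z : Q | ∃ a b : Q, TotallyAbove a 0 ∧ TotallyAbove b 0 ∧ z = a + b} (by
      have h0 : sInf {x : Q | TotallyAbove x 0} = 0 := sInf_totallyAbove 0
      have h1 : ∀ b : Q, b + 0 = sInf ((fun y => b + y) '' {x : Q | TotallyAbove x 0}) := by
        intro b; rw [← add_sInf, h0]
      refine le_trans ?_ h0.le
      refine le_sInf fun b hb => ?_
      rw [← add_zero b, h1 b]
      refine sInf_le_sInf ?_
      rintro _ ⟨a, ha, rfl⟩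
      exact ⟨b, a, hb, ha, rfl⟩)
  exact ⟨a ⊓ b, inf_totallyAbove a b ha hb,
    totallyAbove_mono hqx ((add_le_add' inf_le_left inf_le_right).trans hab)⟩

end ValueQuantale

/-! ## `Q`-metric spaces and the category `Q`-Met -/

/-- A `Q`-metric on the set `X`. -/
class QMetricSpace (Q : Type w) [ValueQuantale Q] (X : Type v) where
  qdist : X → X → Q
  qdist_self : ∀ x, qdist x x = 0
  qdist_comm : ∀ x y, qdist x y = qdist y x
  qdist_triangle : ∀ x y z, qdist x z ≤ qdist x y + qdist y z
  eq_of_qdist_eq_zero : ∀ x y, qdist x y = 0 → x = y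

/-- The `Q`-valued distance. -/
def qdist (Q : Type w) [ValueQuantale Q] {X : Type v} [QMetricSpace Q X] (x y : X) : Q :=
  QMetricSpace.qdist x y

/-- The closure of a subset of a `Q`-metric space, for the topology generated by the open balls
`{y | q ≻ d(x, y)}` with `q ≻ 0`. -/
def qclosure (Q : Type w) [ValueQuantale Q] {X : Type v} [QMetricSpace Q X] (S : Set X) : Set X :=
  {y | ∀ q : Q, TotallyAbove q 0 → ∃ x ∈ S, TotallyAbove q (qdist Q x y)}

/-- The objects of `Q`-Met. -/
structure QMet (Q : Type w) [ValueQuantale Q] : Type (max w (v + 1)) where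
  carrier : Type v
  [str : QMetricSpace Q carrier]

attribute [instance] QMet.str

namespace QMet

variable {Q : Type w} [ValueQuantale Q]

/-- Nonexpanding maps. -/
@[ext]
structure Hom (X Y : QMet.{w, v} Q) where
  toFun : X.carrier → Y.carrier
  nonexpanding : ∀ x x', qdist Q (toFun x) (toFun x') ≤ qdist Q x x'

instance : Category.{v} (QMet.{w, v} Q) where
  Hom X Y := Hom X Y
  id X := ⟨fun x => x, fun _ _ => le_rfl⟩
  comp f g := ⟨fun x => g.toFun (f.toFun x),
    fun x x' => (g.nonexpanding _ _).trans (f.nonexpanding x x')⟩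

theorem hom_ext {X Y : QMet.{w, v} Q} {f g : X ⟶ Y} (h : ∀ x, f.toFun x = g.toFun x) : f = g :=
  Hom.ext (funext h)

/-- Dense maps: every point of the codomain lies in the closure of the image. -/
def IsDense {X Y : QMet.{w, v} Q} (φ : X ⟶ Y) : Prop :=
  ∀ (y : Y.carrier) (q : Q), TotallyAbove q 0 →
    ∃ x : X.carrier, TotallyAbove q (qdist Q (φ.toFun x) y)

/-- Closed isometries: distance preserving maps with closed image. -/
def IsClosedIsometry {X Y : QMet.{w, v} Q} (φ : X ⟶ Y) : Prop :=
  (∀ x x', qdist Q (φ.toFun x) (φ.toFun x') = qdist Q x x') ∧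
    qclosure Q (Set.range φ.toFun) ⊆ Set.range φ.toFun

instance subtypeMetric {X : Type v} [QMetricSpace Q X] (p : X → Prop) :
    QMetricSpace Q {x // p x} where
  qdist x y := qdist Q x.1 y.1
  qdist_self x := QMetricSpace.qdist_self x.1
  qdist_comm x y := QMetricSpace.qdist_comm x.1 y.1
  qdist_triangle x y z := QMetricSpace.qdist_triangle x.1 y.1 z.1
  eq_of_qdist_eq_zero x y h := Subtype.ext (QMetricSpace.eq_of_qdist_eq_zero x.1 y.1 h)

/-- The middle object of the (dense, closed isometry) factorization of `φ`: the closure of the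
image of `φ`, as a subspace of the codomain. -/
def closedImage {X Y : QMet.{w, v} Q} (φ : X ⟶ Y) : QMet.{w, v} Q :=
  ⟨{y : Y.carrier // y ∈ qclosure Q (Set.range φ.toFun)}⟩

theorem totallyAbove_self_zero {q : Q} (h : TotallyAbove q 0) {X : Type v} [QMetricSpace Q X]
    (x : X) : TotallyAbove q (qdist Q x x) := by
  have : qdist Q x x = 0 := QMetricSpace.qdist_self x
  rwa [this]

/-- The dense part of the factorization of `φ`. -/
def toClosedImage {X Y : QMet.{w, v} Q} (φ : X ⟶ Y) : X ⟶ closedImage φ :=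
  { toFun := fun x => ⟨φ.toFun x, fun _ hq => ⟨_, ⟨x, rfl⟩, totallyAbove_self_zero hq _⟩⟩
    nonexpanding := fun x x' => φ.nonexpanding x x' }

/-- The closed isometry in the factorization of `φ`. -/
def closedImageι {X Y : QMet.{w, v} Q} (φ : X ⟶ Y) : closedImage φ ⟶ Y :=
  { toFun := fun y => y.1
    nonexpanding := fun _ _ => le_rfl }

theorem toClosedImage_ι {X Y : QMet.{w, v} Q} (φ : X ⟶ Y) :
    toClosedImage φ ≫ closedImageι φ = φ := rfl

theorem isDense_toClosedImage {X Y : QMet.{w, v} Q} (φ : X ⟶ Y) : IsDense (toClosedImage φ) := by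
  rintro ⟨y, hy⟩ q hq
  obtain ⟨_, ⟨x, rfl⟩, hx⟩ := hy q hq
  exact ⟨x, hx⟩

theorem isClosedIsometry_closedImageι {X Y : QMet.{w, v} Q} (φ : X ⟶ Y) :
    IsClosedIsometry (closedImageι φ) := by
  refine ⟨fun _ _ => rfl, fun y hy => ⟨⟨y, fun q hq => ?_⟩, rfl⟩⟩
  obtain ⟨p, hp, hqp⟩ := ValueQuantale.exists_half hq
  obtain ⟨_, ⟨⟨z, hz⟩, rfl⟩, hzy⟩ := hy p hp
  obtain ⟨x, hx, hxz⟩ := hz p hp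
  exact ⟨x, hx, ValueQuantale.totallyAbove_mono hqp
    ((QMetricSpace.qdist_triangle x z y).trans (ValueQuantale.add_le_add'
      (ValueQuantale.le_of_totallyAbove hxz) (ValueQuantale.le_of_totallyAbove hzy)))⟩

/-- Dense maps are orthogonal to closed isometries. -/
theorem existsUnique_lift {X Y Z W : QMet.{w, v} Q} (e : X ⟶ Y) (he : IsDense e) (m : Z ⟶ W)
    (hm : IsClosedIsometry m) (a : X ⟶ Z) (b : Y ⟶ W) (h : a ≫ m = e ≫ b) :
    ∃! l : Y ⟶ Z, e ≫ l = a ∧ l ≫ m = b := by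
  have inj : ∀ z z', m.toFun z = m.toFun z' → z = z' := fun z z' hz => by
    apply QMetricSpace.eq_of_qdist_eq_zero (Q := Q)
    have h1 := hm.1 z z'
    rw [hz] at h1
    exact h1.symm.trans (QMetricSpace.qdist_self _)
  have key : ∀ y, ∃ z, m.toFun z = b.toFun y := fun y => hm.2 fun q hq => by
    obtain ⟨x, hx⟩ := he y q hq
    refine ⟨_, ⟨a.toFun x, congrFun (congrArg Hom.toFun h) x⟩, ?_⟩
    exact ValueQuantale.totallyAbove_mono hx (b.nonexpanding _ _)
  choose l hl using key
  refine ⟨⟨l, fun y y' => ?_⟩, ⟨hom_ext fun x => inj _ _ ?_, hom_ext hl⟩, ?_⟩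
  · rw [← hm.1, hl, hl]; exact b.nonexpanding _ _
  · exact (hl _).trans (congrFun (congrArg Hom.toFun h) x).symm
  · rintro l' ⟨_, h2⟩
    exact hom_ext fun y => inj _ _ ((congrFun (congrArg Hom.toFun h2) y).trans (hl y).symm)

/-- The pullback of `φ` and `ψ` in `Q`-Met, as a subspace of the product with the join metric. -/
def pullback {X Y Z : QMet.{w, v} Q} (φ : X ⟶ Z) (ψ : Y ⟶ Z) : QMet.{w, v} Q where
  carrier := {p : X.carrier × Y.carrier // φ.toFun p.1 = ψ.toFun p.2}
  str :=
    { qdist := fun p p' => qdist Q p.1.1 p'.1.1 ⊔ qdist Q p.1.2 p'.1.2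
      qdist_self := fun p => by
        have h1 : qdist Q p.1.1 p.1.1 = 0 := QMetricSpace.qdist_self _
        have h2 : qdist Q p.1.2 p.1.2 = 0 := QMetricSpace.qdist_self _
        rw [h1, h2, sup_idem]
      qdist_comm := fun p p' => by
        have h1 : qdist Q p.1.1 p'.1.1 = qdist Q p'.1.1 p.1.1 := QMetricSpace.qdist_comm _ _
        have h2 : qdist Q p.1.2 p'.1.2 = qdist Q p'.1.2 p.1.2 := QMetricSpace.qdist_comm _ _
        rw [h1, h2]
      qdist_triangle := fun p p' p'' => sup_le
        ((QMetricSpace.qdist_triangle _ p'.1.1 _).trans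
          (ValueQuantale.add_le_add' le_sup_left le_sup_left))
        ((QMetricSpace.qdist_triangle _ p'.1.2 _).trans
          (ValueQuantale.add_le_add' le_sup_right le_sup_right))
      eq_of_qdist_eq_zero := fun p p' h => by
        have h1 : qdist Q p.1.1 p'.1.1 = 0 :=
          le_antisymm (h ▸ le_sup_left) (ValueQuantale.zero_le' _)
        have h2 : qdist Q p.1.2 p'.1.2 = 0 :=
          le_antisymm (h ▸ le_sup_right) (ValueQuantale.zero_le' _)
        exact Subtype.ext (Prod.ext (QMetricSpace.eq_of_qdist_eq_zero _ _ h1)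
          (QMetricSpace.eq_of_qdist_eq_zero _ _ h2)) }

/-- First projection of the pullback. -/
def pullbackFst {X Y Z : QMet.{w, v} Q} (φ : X ⟶ Z) (ψ : Y ⟶ Z) : pullback φ ψ ⟶ X :=
  { toFun := fun p => p.1.1
    nonexpanding := fun _ _ => le_sup_left }

/-- Second projection of the pullback. -/
def pullbackSnd {X Y Z : QMet.{w, v} Q} (φ : X ⟶ Z) (ψ : Y ⟶ Z) : pullback φ ψ ⟶ Y :=
  { toFun := fun p => p.1.2
    nonexpanding := fun _ _ => le_sup_right }

/-- The map into the pullback induced by its universal property. -/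
def pullbackLift {W X Y Z : QMet.{w, v} Q} {φ : X ⟶ Z} {ψ : Y ⟶ Z} (a : W ⟶ X) (b : W ⟶ Y)
    (h : a ≫ φ = b ≫ ψ) : W ⟶ pullback φ ψ :=
  { toFun := fun x => ⟨(a.toFun x, b.toFun x), congrFun (congrArg Hom.toFun h) x⟩
    nonexpanding := fun x x' => sup_le (a.nonexpanding x x') (b.nonexpanding x x') }

theorem isPullback {X Y Z : QMet.{w, v} Q} (φ : X ⟶ Z) (ψ : Y ⟶ Z) :
    IsPullback (pullbackFst φ ψ) (pullbackSnd φ ψ) φ ψ :=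
  { w := hom_ext fun p => p.2
    isLimit' := ⟨PullbackCone.IsLimit.mk _ (fun s => pullbackLift s.fst s.snd s.condition)
      (fun _ => rfl) (fun _ => rfl) (fun _ _ h1 h2 => hom_ext fun x => Subtype.ext (Prod.ext
        (congrFun (congrArg Hom.toFun h1) x) (congrFun (congrArg Hom.toFun h2) x)))⟩ }

/-- The internal hom `[X, Y]`: nonexpanding maps with the supremum distance. -/
def ihom (X Y : QMet.{w, v} Q) : QMet.{w, v} Q where
  carrier := X ⟶ Y
  str :=
    { qdist := fun f g => ⨆ x : X.carrier, qdist Q (f.toFun x) (g.toFun x)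
      qdist_self := fun f => le_antisymm
        (iSup_le fun x => (QMetricSpace.qdist_self (Q := Q) (f.toFun x)).le)
        (ValueQuantale.zero_le' _)
      qdist_comm := fun _ _ => iSup_congr fun _ => QMetricSpace.qdist_comm _ _
      qdist_triangle := fun f g h => iSup_le fun x =>
        (QMetricSpace.qdist_triangle _ (g.toFun x) _).trans
          (ValueQuantale.add_le_add' (le_iSup (fun x => qdist Q (f.toFun x) (g.toFun x)) x)
            (le_iSup (fun x => qdist Q (g.toFun x) (h.toFun x)) x))
      eq_of_qdist_eq_zero := fun _ _ h => hom_ext fun x =>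
        QMetricSpace.eq_of_qdist_eq_zero (Q := Q) _ _ (le_antisymm
          (h ▸ le_iSup (fun _ => qdist Q _ _) x)
          (ValueQuantale.zero_le' _)) }

open Classical in
/-- The space `2_q` with exactly two points, at distance `q ≠ 0`. -/
noncomputable def two (q : Q) (hq : q ≠ 0) : QMet.{w, v} Q where
  carrier := ULift.{v} Bool
  str :=
    { qdist := fun i j => if i = j then 0 else q
      qdist_self := fun i => if_pos rfl
      qdist_comm := fun i j => by simp only [eq_comm]
      qdist_triangle := fun i j k => by
        by_cases hik : i = k
        · rw [if_pos hik]; exact ValueQuantale.zero_le' _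
        · rw [if_neg hik]
          by_cases hij : i = j
          · rw [if_pos hij, if_neg (hij ▸ hik), zero_add]
          · rw [if_neg hij]; exact ValueQuantale.le_add_right' _ _
      eq_of_qdist_eq_zero := fun i j h => by
        by_contra hij
        rw [if_neg hij] at h
        exact hq h }

end QMet

/-! ## Categories enriched over `Q`-Met -/

/-- A `Q`-Met-enriched category: `Q`-metrics on the hom-sets such that composition
`K(X, Y) ⊗ K(Y, Z) → K(X, Z)` is nonexpanding, where `⊗` carries the sum metric. The ordinary
category structure is that of the underlying category. -/
class QMetCategory (Q : Type w) [ValueQuantale Q] (K : Type u) [Category.{v} K] where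
  homMetric : ∀ X Y : K, QMetricSpace Q (X ⟶ Y)
  comp_nonexpanding : ∀ {X Y Z : K} (a a' : X ⟶ Y) (b b' : Y ⟶ Z),
    qdist Q (a ≫ b) (a' ≫ b') ≤ qdist Q a a' + qdist Q b b'

attribute [reducible, instance] QMetCategory.homMetric

namespace QMetCategory

variable (Q : Type w) [ValueQuantale Q] {K : Type u} [Category.{v} K] [QMetCategory Q K]

/-- The hom-object `K(X, Y)` in `Q`-Met. -/
def hom (X Y : K) : QMet.{w, v} Q := ⟨X ⟶ Y⟩

/-- The map `K(A, f) : K(A, X) ⟶ K(A, Y)`. -/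
def postcomp (A : K) {X Y : K} (f : X ⟶ Y) : hom Q A X ⟶ hom Q A Y :=
  { toFun := fun (a : A ⟶ X) => (a ≫ f : A ⟶ Y)
    nonexpanding := fun (a a' : A ⟶ X) => by
      have h := comp_nonexpanding (Q := Q) a a' f f
      have h0 : qdist Q f f = 0 := QMetricSpace.qdist_self _
      rw [h0, add_zero] at h
      exact h }

/-- The map `K(g, X) : K(B, X) ⟶ K(A, X)`. -/
def precomp {A B : K} (g : A ⟶ B) (X : K) : hom Q B X ⟶ hom Q A X :=
  { toFun := fun (b : B ⟶ X) => (g ≫ b : A ⟶ X)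
    nonexpanding := fun (b b' : B ⟶ X) => by
      have h := comp_nonexpanding (Q := Q) g g b b'
      have h0 : qdist Q g g = 0 := QMetricSpace.qdist_self _
      rw [h0, zero_add] at h
      exact h }

theorem precomp_postcomp {A B X Y : K} (g : A ⟶ B) (f : X ⟶ Y) :
    precomp Q g X ≫ postcomp Q A f = postcomp Q B f ≫ precomp Q g Y :=
  QMet.hom_ext fun (b : B ⟶ X) => Category.assoc g b f

/-- The functor `K(A, -)` with values in `Q`-Met. -/
def covHom (A : K) : K ⥤ QMet.{w, v} Q where
  obj X := hom Q A X
  map f := postcomp Q A f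
  map_id X := QMet.hom_ext fun (a : A ⟶ X) => Category.comp_id a
  map_comp {X _ _} f f' := QMet.hom_ext fun (a : A ⟶ X) => (Category.assoc a f f').symm

/-- The functor `K(-, X)` with values in `Q`-Met. -/
def contraHom (X : K) : Kᵒᵖ ⥤ QMet.{w, v} Q where
  obj A := hom Q A.unop X
  map g := precomp Q g.unop X
  map_id A := QMet.hom_ext fun (a : A.unop ⟶ X) => Category.id_comp a
  map_comp {A _ _} g g' := QMet.hom_ext fun (a : A.unop ⟶ X) => Category.assoc g'.unop g.unop a

/-- A cocone is a conical colimit if every `K(-, X)` sends it to a limit cone in `Q`-Met, that is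
`K(colim H, X) ≅ lim K(H -, X)` in `Q`-Met. -/
def IsConicalColimit {J : Type v} [SmallCategory J] {H : J ⥤ K} (c : Cocone H) : Prop :=
  ∀ X : K, Nonempty (IsLimit ((contraHom Q X).mapCone c.op))

/-- The comparison `K(P, L) ⟶ [X, K(A, L)]` determined by a map `η : X ⟶ K(A, P)`. -/
def copowerComparison {X : QMet.{w, v} Q} {A P : K} (η : X ⟶ hom Q A P) (L : K) :
    hom Q P L ⟶ QMet.ihom X (hom Q A L) :=
  { toFun := fun (t : P ⟶ L) => η ≫ postcomp Q A t
    nonexpanding := fun (t t' : P ⟶ L) => iSup_le fun x =>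
      (precomp Q (show A ⟶ P from η.toFun x) L).nonexpanding t t' }

/-- `P`, with unit `η : X ⟶ K(A, P)`, is the copower `X · A`: the maps
`K(P, L) ⟶ [X, K(A, L)]` are isomorphisms in `Q`-Met. -/
def IsCopower {X : QMet.{w, v} Q} {A P : K} (η : X ⟶ hom Q A P) : Prop :=
  ∀ L : K, IsIso (copowerComparison Q η L)

/-- `A` is `κ`-presentable in the enriched sense: `K(A, -) : K ⥤ Q`-Met preserves `κ`-filtered
colimits. -/
def IsPresentableObj (κ : Cardinal.{v}) [Fact κ.IsRegular] (A : K) : Prop :=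
  (covHom Q A).IsCardinalAccessible κ

variable (K) in
/-- Locally `κ`-presentable `Q`-Met-enriched categories: all small conical colimits and all
copowers exist, the `κ`-presentable objects form an essentially small subcategory, and every
object is a (conical) `κ`-filtered colimit of `κ`-presentable objects. -/
structure IsLocallyPresentable (κ : Cardinal.{v}) [Fact κ.IsRegular] : Prop where
  conicalColimits : ∀ (J : Type v) [SmallCategory J] (H : J ⥤ K),
    ∃ c : Cocone H, IsConicalColimit Q c
  copowers : ∀ (X : QMet.{w, v} Q) (A : K), ∃ (P : K) (η : X ⟶ hom Q A P), IsCopower Q η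
  essentiallySmall :
    ObjectProperty.EssentiallySmall.{v} (fun A : K => IsPresentableObj Q κ A)
  filteredColimit : ∀ X : K, ∃ (J : Type v) (_ : SmallCategory J) (_ : IsCardinalFiltered J κ)
    (H : J ⥤ K) (ι : H ⟶ (Functor.const J).obj X),
    IsConicalColimit Q (Cocone.mk X ι) ∧ ∀ j, IsPresentableObj Q κ (H.obj j)

/-! ## The three notions of purity, for `E` the class of dense maps -/

/-- `P(g, f)`: the pullback along `K(A, f)` of the closed isometry `P(g, Y) ⟶ K(A, Y)` in the
(dense, closed isometry) factorization of `K(g, Y)`. -/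
def pureObj {A B X Y : K} (g : A ⟶ B) (f : X ⟶ Y) : QMet.{w, v} Q :=
  QMet.pullback (postcomp Q A f) (QMet.closedImageι (precomp Q g Y))

/-- The induced map `r : K(B, X) ⟶ P(g, f)`. -/
def pureMap {A B X Y : K} (g : A ⟶ B) (f : X ⟶ Y) : hom Q B X ⟶ pureObj Q g f :=
  QMet.pullbackLift (precomp Q g X) (postcomp Q B f ≫ QMet.toClosedImage (precomp Q g Y))
    (by rw [Category.assoc, QMet.toClosedImage_ι, precomp_postcomp])

/-- `f` is `(κ, E)`-pure. -/
def IsPure (κ : Cardinal.{v}) [Fact κ.IsRegular] {X Y : K} (f : X ⟶ Y) : Prop :=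
  ∀ ⦃A B : K⦄ (g : A ⟶ B), IsPresentableObj Q κ A → IsPresentableObj Q κ B →
    QMet.IsDense (pureMap Q g f)

/-- The hom-object `K^→(g, f)` of the arrow category, i.e. the space of commutative squares
`(u, v)` from `g` to `f`. -/
def arrowHom {A B X Y : K} (g : A ⟶ B) (f : X ⟶ Y) : QMet.{w, v} Q :=
  QMet.pullback (postcomp Q A f) (precomp Q g Y)

/-- The projection `p : K^→(g, f) ⟶ K(A, X)`, `(u, v) ↦ u`. -/
def arrowProj {A B X Y : K} (g : A ⟶ B) (f : X ⟶ Y) : arrowHom Q g f ⟶ hom Q A X :=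
  QMet.pullbackFst (postcomp Q A f) (precomp Q g Y)

/-- The map `q' : K(B, X) ⟶ K^→(g, f)`, `t ↦ (g ≫ t, t ≫ f)`. -/
def toArrowHom {A B X Y : K} (g : A ⟶ B) (f : X ⟶ Y) : hom Q B X ⟶ arrowHom Q g f :=
  QMet.pullbackLift (precomp Q g X) (postcomp Q B f) (precomp_postcomp Q g f)

/-- The map `q : K(B, X) ⟶ Q(g, f)`, where `Q(g, f)` is the middle object of the
(dense, closed isometry) factorization of the projection `p`. -/
def barePureMap {A B X Y : K} (g : A ⟶ B) (f : X ⟶ Y) :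
    hom Q B X ⟶ QMet.closedImage (arrowProj Q g f) :=
  toArrowHom Q g f ≫ QMet.toClosedImage (arrowProj Q g f)

/-- `f` is barely `(κ, E)`-pure. -/
def IsBarelyPure (κ : Cardinal.{v}) [Fact κ.IsRegular] {X Y : K} (f : X ⟶ Y) : Prop :=
  ∀ ⦃A B : K⦄ (g : A ⟶ B), IsPresentableObj Q κ A → IsPresentableObj Q κ B →
    QMet.IsDense (barePureMap Q g f)

/-- `f` is weakly `(κ, E)`-pure: for all `q ≻ 0` and every `q`-commutative square `(u, v)` from
`g` to `f` there is `t` with `d(g ≫ t, u) ≤ 2q`. -/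
def IsWeaklyPure (κ : Cardinal.{v}) [Fact κ.IsRegular] {X Y : K} (f : X ⟶ Y) : Prop :=
  ∀ q : Q, TotallyAbove q 0 →
    ∀ ⦃A B : K⦄ (g : A ⟶ B), IsPresentableObj Q κ A → IsPresentableObj Q κ B →
      ∀ (u : A ⟶ X) (v : B ⟶ Y), qdist Q (u ≫ f) (g ≫ v) ≤ q →
        ∃ t : B ⟶ X, qdist Q (g ≫ t) u ≤ q + q

end QMetCategory

/-!
Only one implication needs an argument: a barely pure `f : X ⟶ Y` is weakly pure. (From weakly
pure to pure and from pure to barely pure one halves `q`.) A square from `g : A ⟶ B` to `f` that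
commutes up to `q` is made into a strictly commuting one by replacing `g` with the leg
`h : A ⟶ C` of the universal triangle `h : A ⟶ C`, `b : B ⟶ C` with `d(h, g ≫ b) ≤ q`
(`IsApproxPushout`). Bare purity of `f` for `h` yields `t : C ⟶ X` with `d(h ≫ t, u) ≤ q`, and
`b ≫ t` then solves the original problem up to `q + q`.

The object `C` exists for `q ≠ 0`, as the pushout along `g` of a leg of the copower `2_q · A`
(`exists_isApproxPushout`). The main point is that `C` is presentable if `A` and `B` are
(`IsApproxPushout.isPresentableObj`). Since `K(C, Z)` is the space of the pairs in
`K(A, Z) × K(B, Z)` that commute up to `q`, this amounts to a commutation of that limit with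
`κ`-filtered colimits in `Q`-Met. Colimits of filtered diagrams are computed there as the metric
quotient of the disjoint union with the infimum distance (`isMetricColimit_of_isColimit`,
`IsMetricColimit.isColimit`). In general such an infimum is not attained, and the commutation
fails. Presentability of the spaces `2_q` makes it hold: that of `2_⊤`, which represents pairs of
arbitrary points, shows that points equal in the colimit are equal at some stage, and that of `2_q`
then shows that a distance `≤ q` in the colimit is already `≤ q` at some stage
(`exists_qdist_map_le_of_isColimit`).
-/

/-! ### Value quantales and `Q`-metrics -/

namespace ValueQuantale

variable {Q : Type w} [ValueQuantale Q]

theorem le_of_forall_totallyAbove {a b : Q} (h : ∀ q, TotallyAbove q b → a ≤ q) : a ≤ b :=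
  (le_sInf h).trans (sInf_totallyAbove b).le

theorem eq_zero_of_le {a : Q} (h : a ≤ 0) : a = 0 := le_antisymm h (zero_le' a)

theorem le_sInf_add_sInf {a : Q} {S T : Set Q} (h : ∀ s ∈ S, ∀ t ∈ T, a ≤ s + t) :
    a ≤ sInf S + sInf T := by
  rw [add_sInf]
  refine le_sInf ?_
  rintro _ ⟨t, ht, rfl⟩
  dsimp only
  rw [add_comm, add_sInf]
  refine le_sInf ?_
  rintro _ ⟨s, hs, rfl⟩
  exact (h s hs t ht).trans (add_comm s t).le

/-- In a nontrivial value quantale only nonempty sets have infimum `0`. -/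
theorem totallyAbove_top_zero (h : (⊤ : Q) ≠ 0) : TotallyAbove (⊤ : Q) 0 := by
  intro S hS
  rcases S.eq_empty_or_nonempty with rfl | ⟨s, hs⟩
  · rw [sInf_empty] at hS
    exact absurd (eq_zero_of_le hS) h
  · exact ⟨s, hs, le_top⟩

end ValueQuantale

section Distance

variable {Q : Type w} [ValueQuantale Q] {X : Type v} [QMetricSpace Q X]

theorem qdist_self (x : X) : qdist Q x x = 0 := QMetricSpace.qdist_self x

theorem qdist_comm (x y : X) : qdist Q x y = qdist Q y x := QMetricSpace.qdist_comm x y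

theorem qdist_triangle (x y z : X) : qdist Q x z ≤ qdist Q x y + qdist Q y z :=
  QMetricSpace.qdist_triangle x y z

theorem eq_of_qdist_le_zero {x y : X} (h : qdist Q x y ≤ 0) : x = y :=
  QMetricSpace.eq_of_qdist_eq_zero x y (ValueQuantale.eq_zero_of_le h)

end Distance

namespace QMet

variable {Q : Type w} [ValueQuantale Q]

theorem congr_toFun {X Y : QMet.{w, v} Q} {φ ψ : X ⟶ Y} (h : φ = ψ) (x : X.carrier) :
    φ.toFun x = ψ.toFun x := h ▸ rfl

/-! ### Metric quotients -/

section Pseudometric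

variable {T : Type v} (d : T → T → Q) (h0 : ∀ x, d x x = 0) (hc : ∀ x y, d x y = d y x)
  (ht : ∀ x y z, d x z ≤ d x y + d y z)

include h0 hc ht in
theorem pseudoSetoid_iseqv : Equivalence fun x y => d x y = 0 where
  refl := h0
  symm {x y} h := (hc y x).trans h
  trans {x y z} h h' := ValueQuantale.eq_zero_of_le ((ht x y z).trans (by rw [h, h', add_zero]))

/-- The metric quotient of a `Q`-pseudometric: points at distance `0` are identified. -/
def ofPseudometric : QMet.{w, v} Q where
  carrier := Quotient ⟨fun x y => d x y = 0, pseudoSetoid_iseqv d h0 hc ht⟩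
  str :=
    { qdist := Quotient.lift₂ d (by
        have key : ∀ a₁ b₁ a₂ b₂, d a₁ a₂ = 0 → d b₁ b₂ = 0 → d a₁ b₁ ≤ d a₂ b₂ := by
          intro a₁ b₁ a₂ b₂ ha hb
          refine (ht a₁ a₂ b₁).trans ?_
          rw [ha, zero_add]
          refine (ht a₂ b₂ b₁).trans ?_
          rw [hc b₂, hb, add_zero]
        intro a₁ b₁ a₂ b₂ ha hb
        exact le_antisymm (key _ _ _ _ ha hb)
          (key _ _ _ _ ((hc _ _).trans ha) ((hc _ _).trans hb)))
      qdist_self := by rintro ⟨x⟩; exact h0 x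
      qdist_comm := by rintro ⟨x⟩ ⟨y⟩; exact hc x y
      qdist_triangle := by rintro ⟨x⟩ ⟨y⟩ ⟨z⟩; exact ht x y z
      eq_of_qdist_eq_zero := by rintro ⟨x⟩ ⟨y⟩ h; exact Quotient.sound h }

/-- The projection onto the metric quotient. -/
def ofPseudometricMk (x : T) : (ofPseudometric d h0 hc ht).carrier := Quotient.mk _ x

theorem qdist_ofPseudometricMk (x y : T) :
    qdist Q (ofPseudometricMk d h0 hc ht x) (ofPseudometricMk d h0 hc ht y) = d x y := rfl

end Pseudometric

/-! ### Filtered colimits of `Q`-metric spaces -/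

/-- A cocone in `Q`-Met whose legs are jointly surjective and whose distances are the infima of
the distances along the diagram. The second condition is phrased with `≻`: each `q` totally above
the distance in the apex bounds the distance at some stage. For filtered diagrams these are
exactly the colimit cocones. -/
structure IsMetricColimit {J : Type v} [SmallCategory J] {H : J ⥤ QMet.{w, v} Q}
    (c : Cocone H) : Prop where
  surj : ∀ z : c.pt.carrier, ∃ (j : J) (x : (H.obj j).carrier), (c.ι.app j).toFun x = z
  dist : ∀ (j : J) (x y : (H.obj j).carrier) (q : Q),
    TotallyAbove q (qdist Q ((c.ι.app j).toFun x) ((c.ι.app j).toFun y)) →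
      ∃ (k : J) (f : j ⟶ k), qdist Q ((H.map f).toFun x) ((H.map f).toFun y) ≤ q

section

variable {J : Type v} [SmallCategory J] {H : J ⥤ QMet.{w, v} Q}

theorem cocone_w_apply (c : Cocone H) {j k : J} (f : j ⟶ k) (x : (H.obj j).carrier) :
    (c.ι.app k).toFun ((H.map f).toFun x) = (c.ι.app j).toFun x :=
  congr_toFun (c.w f) x

variable (H) in
/-- The pseudometric on the disjoint union of the spaces of a diagram: the infimum of the
distances of the images at all later stages. -/
def colimitDist (a b : Σ j : J, (H.obj j).carrier) : Q :=
  sInf {r | ∃ (k : J) (f : a.1 ⟶ k) (g : b.1 ⟶ k),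
    r = qdist Q ((H.map f).toFun a.2) ((H.map g).toFun b.2)}

theorem colimitDist_le {a b : Σ j : J, (H.obj j).carrier} {k : J} (f : a.1 ⟶ k) (g : b.1 ⟶ k) :
    colimitDist H a b ≤ qdist Q ((H.map f).toFun a.2) ((H.map g).toFun b.2) :=
  sInf_le ⟨k, f, g, rfl⟩

theorem qdist_map_comp_le {i j k l : J} (f : i ⟶ k) (g : j ⟶ k) (h : k ⟶ l)
    (x : (H.obj i).carrier) (y : (H.obj j).carrier) :
    qdist Q ((H.map (f ≫ h)).toFun x) ((H.map (g ≫ h)).toFun y) ≤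
      qdist Q ((H.map f).toFun x) ((H.map g).toFun y) := by
  rw [H.map_comp, H.map_comp]
  exact (H.map h).nonexpanding _ _

theorem colimitDist_self (a : Σ j : J, (H.obj j).carrier) : colimitDist H a a = 0 :=
  ValueQuantale.eq_zero_of_le ((colimitDist_le (𝟙 _) (𝟙 _)).trans (qdist_self _).le)

theorem colimitDist_comm (a b : Σ j : J, (H.obj j).carrier) :
    colimitDist H a b = colimitDist H b a := by
  have key : ∀ a b, colimitDist H a b ≤ colimitDist H b a := by
    intro a b
    refine le_sInf ?_
    rintro _ ⟨k, f, g, rfl⟩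
    exact (colimitDist_le g f).trans (qdist_comm _ _).le
  exact le_antisymm (key a b) (key b a)

variable [IsFiltered J]

theorem IsMetricColimit.isColimit {c : Cocone H} (hc : IsMetricColimit c) :
    Nonempty (IsColimit c) := by
  have same : ∀ (s : Cocone H) (j : J) (x y : (H.obj j).carrier),
      qdist Q ((s.ι.app j).toFun x) ((s.ι.app j).toFun y) ≤
        qdist Q ((c.ι.app j).toFun x) ((c.ι.app j).toFun y) := by
    intro s j x y
    refine ValueQuantale.le_of_forall_totallyAbove fun q hq => ?_
    obtain ⟨k, f, hf⟩ := hc.dist j x y q hq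
    rw [← cocone_w_apply s f, ← cocone_w_apply s f]
    exact ((s.ι.app k).nonexpanding _ _).trans hf
  have key : ∀ (s : Cocone H) (j j' : J) (x : (H.obj j).carrier) (x' : (H.obj j').carrier),
      qdist Q ((s.ι.app j).toFun x) ((s.ι.app j').toFun x') ≤
        qdist Q ((c.ι.app j).toFun x) ((c.ι.app j').toFun x') := by
    intro s j j' x x'
    have h := same s (IsFiltered.max j j') ((H.map (IsFiltered.leftToMax j j')).toFun x)
      ((H.map (IsFiltered.rightToMax j j')).toFun x')
    rwa [cocone_w_apply, cocone_w_apply, cocone_w_apply, cocone_w_apply] at h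
  choose i x hx using hc.surj
  have lift : ∀ (s : Cocone H) (j : J) (y : (H.obj j).carrier),
      (s.ι.app (i ((c.ι.app j).toFun y))).toFun (x ((c.ι.app j).toFun y)) =
        (s.ι.app j).toFun y := by
    intro s j y
    refine eq_of_qdist_le_zero (Q := Q) ((key s _ _ _ _).trans ?_)
    rw [hx, qdist_self]
  refine ⟨⟨fun s => ⟨fun z => (s.ι.app (i z)).toFun (x z), fun z z' => ?_⟩, fun s j => ?_,
    fun s m hm => ?_⟩⟩
  · refine (key s _ _ _ _).trans ?_
    rw [hx, hx]
  · exact hom_ext fun y => lift s j y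
  · refine hom_ext fun z => ?_
    change m.toFun z = (s.ι.app (i z)).toFun (x z)
    rw [← hm, ← congrArg m.toFun (hx z)]
    rfl

theorem colimitDist_triangle (a b c : Σ j : J, (H.obj j).carrier) :
    colimitDist H a c ≤ colimitDist H a b + colimitDist H b c := by
  refine ValueQuantale.le_sInf_add_sInf ?_
  rintro _ ⟨k, f, g, rfl⟩ _ ⟨l, g', h, rfl⟩
  obtain ⟨m, s, t, hst⟩ := IsFiltered.span g g'
  refine (colimitDist_le (f ≫ s) (h ≫ t)).trans
    ((qdist_triangle _ ((H.map (g ≫ s)).toFun b.2) _).trans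
      (ValueQuantale.add_le_add' (qdist_map_comp_le f g s _ _) ?_))
  rw [hst]
  exact qdist_map_comp_le g' h t _ _

variable (H) in
/-- The colimit cocone of a filtered diagram, on the metric quotient of the disjoint union. -/
def filteredCocone : Cocone H where
  pt := ofPseudometric (colimitDist H) colimitDist_self colimitDist_comm colimitDist_triangle
  ι :=
    { app := fun j =>
        { toFun := fun x => ofPseudometricMk _ _ _ _ ⟨j, x⟩
          nonexpanding := fun x y => by
            rw [qdist_ofPseudometricMk]
            refine (colimitDist_le (𝟙 j) (𝟙 j)).trans ?_
            rw [H.map_id]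
            exact le_rfl }
      naturality := fun j k f => hom_ext fun x => by
        refine eq_of_qdist_le_zero (Q := Q) ?_
        change colimitDist H ⟨k, (H.map f).toFun x⟩ ⟨j, x⟩ ≤ 0
        refine (colimitDist_le (𝟙 k) f).trans ?_
        rw [H.map_id]
        exact (qdist_self (Q := Q) ((H.map f).toFun x)).le }

variable (H) in
theorem isMetricColimit_filteredCocone : IsMetricColimit (filteredCocone H) where
  surj := by
    rintro ⟨⟨j, x⟩⟩
    exact ⟨j, x, rfl⟩
  dist j x y q hq := by
    obtain ⟨_, ⟨k, f, g, rfl⟩, hk⟩ := hq _ le_rfl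
    refine ⟨IsFiltered.coeq f g, f ≫ IsFiltered.coeqHom f g, ?_⟩
    refine le_trans (le_of_eq ?_) ((qdist_map_comp_le f g (IsFiltered.coeqHom f g) x y).trans hk)
    rw [IsFiltered.coeq_condition f g]

theorem isMetricColimit_of_isColimit {c : Cocone H} (hc : IsColimit c) : IsMetricColimit c := by
  obtain ⟨h₀⟩ := (isMetricColimit_filteredCocone H).isColimit
  have fac : ∀ j x, (hc.desc (filteredCocone H)).toFun ((c.ι.app j).toFun x) =
      ((filteredCocone H).ι.app j).toFun x := fun j x => congr_toFun (hc.fac _ j) x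
  constructor
  · intro z
    obtain ⟨j, x, hx⟩ := (isMetricColimit_filteredCocone H).surj
      ((hc.desc (filteredCocone H)).toFun z)
    refine ⟨j, x, ?_⟩
    have h1 : hc.desc (filteredCocone H) ≫ h₀.desc c = 𝟙 _ :=
      hc.hom_ext fun j => by rw [← Category.assoc, hc.fac, h₀.fac, Category.comp_id]
    refine Eq.trans ?_ (congr_toFun h1 z)
    refine Eq.trans ?_ (congrArg (h₀.desc c).toFun hx)
    exact (congr_toFun (h₀.fac c j) x).symm
  · intro j x y q hq
    refine (isMetricColimit_filteredCocone H).dist j x y q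
      (ValueQuantale.totallyAbove_mono hq ?_)
    rw [← fac, ← fac]
    exact (hc.desc _).nonexpanding _ _

end

/-! ### Two-point spaces -/

/-- The map out of `2_q` determined by two points at distance at most `q`. -/
def twoDesc {q : Q} (hq : q ≠ 0) {X : QMet.{w, v} Q} (x y : X.carrier)
    (h : qdist Q x y ≤ q) : two.{w, v} q hq ⟶ X where
  toFun i := if i.down then y else x
  nonexpanding := by
    have h' : qdist Q y x ≤ q := (qdist_comm y x).le.trans h
    rintro ⟨i⟩ ⟨j⟩
    change _ ≤ if (ULift.up i : ULift.{v} Bool) = ULift.up j then (0 : Q) else q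
    cases i <;> cases j <;> simp [qdist_self, h, h']

theorem qdist_two {q : Q} (hq : q ≠ 0) :
    qdist Q (X := (two.{w, v} q hq).carrier) ⟨false⟩ ⟨true⟩ = q := by
  change (if (ULift.up false : ULift.{v} Bool) = ULift.up true then (0 : Q) else q) = q
  exact if_neg fun h => Bool.false_ne_true (congrArg ULift.down h)

theorem two_hom_ext {q : Q} {hq : q ≠ 0} {X : QMet.{w, v} Q} {φ ψ : two.{w, v} q hq ⟶ X}
    (h₀ : φ.toFun ⟨false⟩ = ψ.toFun ⟨false⟩) (h₁ : φ.toFun ⟨true⟩ = ψ.toFun ⟨true⟩) : φ = ψ := by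
  refine hom_ext ?_
  rintro ⟨_ | _⟩
  · exact h₀
  · exact h₁

section

variable {κ : Cardinal.{v}} [Fact κ.IsRegular]
  (hκ : ∀ (q : Q) (hq : q ≠ 0), TotallyAbove q 0 →
    IsCardinalPresentable (QMet.two.{w, v} q hq) κ)
  {J : Type v} [SmallCategory J] [IsCardinalFiltered J κ] {H : J ⥤ QMet.{w, v} Q}
  {c : Cocone H} (hc : IsColimit c)

include hκ hc

/-- Two points that agree in a `κ`-filtered colimit agree at some stage: the space `2_⊤`
represents pairs of arbitrary points. -/
theorem exists_map_eq_of_isColimit {j : J} (x y : (H.obj j).carrier)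
    (h : (c.ι.app j).toFun x = (c.ι.app j).toFun y) :
    ∃ (k : J) (f : j ⟶ k), (H.map f).toFun x = (H.map f).toFun y := by
  by_cases ht : (⊤ : Q) = 0
  · exact ⟨j, 𝟙 j, eq_of_qdist_le_zero (Q := Q) (ht ▸ le_top)⟩
  · have := hκ ⊤ ht (ValueQuantale.totallyAbove_top_zero ht)
    obtain ⟨k, f, hf⟩ := IsCardinalPresentable.exists_eq_of_isColimit' κ hc
      (twoDesc ht x x le_top) (twoDesc ht x y le_top) (two_hom_ext rfl h)
    exact ⟨k, f, congr_toFun hf ⟨true⟩⟩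

/-- For `q ≻ 0` a distance `≤ q` in a `κ`-filtered colimit is attained at some stage. -/
theorem exists_qdist_map_le_of_isColimit {q : Q} (hq : TotallyAbove q 0) {j : J}
    (x y : (H.obj j).carrier)
    (h : qdist Q ((c.ι.app j).toFun x) ((c.ι.app j).toFun y) ≤ q) :
    ∃ (k : J) (f : j ⟶ k), qdist Q ((H.map f).toFun x) ((H.map f).toFun y) ≤ q := by
  by_cases hq0 : q = 0
  · obtain ⟨k, f, hf⟩ := exists_map_eq_of_isColimit hκ hc x y
      (eq_of_qdist_le_zero (h.trans hq0.le))
    refine ⟨k, f, ?_⟩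
    rw [hf, qdist_self]
    exact ValueQuantale.zero_le' q
  · have := hκ q hq0 hq
    have := isFiltered_of_isCardinalFiltered J κ
    obtain ⟨i, φ, hφ⟩ := IsCardinalPresentable.exists_hom_of_isColimit κ hc (twoDesc hq0 _ _ h)
    have h₀ : (c.ι.app i).toFun (φ.toFun ⟨false⟩) = (c.ι.app j).toFun x := congr_toFun hφ ⟨false⟩
    have h₁ : (c.ι.app i).toFun (φ.toFun ⟨true⟩) = (c.ι.app j).toFun y := congr_toFun hφ ⟨true⟩
    have hd : qdist Q (φ.toFun ⟨false⟩) (φ.toFun ⟨true⟩) ≤ q :=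
      (φ.nonexpanding _ _).trans (qdist_two hq0).le
    let a : i ⟶ IsFiltered.max i j := IsFiltered.leftToMax i j
    let b : j ⟶ IsFiltered.max i j := IsFiltered.rightToMax i j
    obtain ⟨k, f, hf⟩ := exists_map_eq_of_isColimit hκ hc ((H.map a).toFun (φ.toFun ⟨false⟩))
      ((H.map b).toFun x) (by rw [cocone_w_apply, cocone_w_apply, h₀])
    obtain ⟨l, g, hg⟩ := exists_map_eq_of_isColimit hκ hc
      ((H.map f).toFun ((H.map a).toFun (φ.toFun ⟨true⟩)))
      ((H.map f).toFun ((H.map b).toFun y)) (by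
        rw [cocone_w_apply, cocone_w_apply, cocone_w_apply, cocone_w_apply, h₁])
    refine ⟨l, b ≫ f ≫ g, ?_⟩
    rw [H.map_comp, H.map_comp]
    change qdist Q ((H.map g).toFun ((H.map f).toFun ((H.map b).toFun x)))
      ((H.map g).toFun ((H.map f).toFun ((H.map b).toFun y))) ≤ q
    rw [← hf, ← hg]
    exact ((H.map g).nonexpanding _ _).trans (((H.map f).nonexpanding _ _).trans
      (((H.map a).nonexpanding _ _).trans hd))

end

/-! ### Limits of `Q`-metric spaces -/

section

variable {J : Type v} [SmallCategory J] {H : Jᵒᵖ ⥤ QMet.{w, v} Q} {c : Cone H}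

/-- Compatible families are points of the limit: they are cones over a one-point space. -/
theorem exists_point_of_isLimit (hc : IsLimit c) (x : ∀ j, (H.obj j).carrier)
    (hx : ∀ ⦃i j : Jᵒᵖ⦄ (f : i ⟶ j), (H.map f).toFun (x i) = x j) :
    ∃ z : c.pt.carrier, ∀ j, (c.π.app j).toFun z = x j := by
  let E : QMet.{w, v} Q :=
    { carrier := PUnit
      str :=
        { qdist := fun _ _ => 0
          qdist_self := fun _ => rfl
          qdist_comm := fun _ _ => rfl
          qdist_triangle := fun _ _ _ => ValueQuantale.zero_le' _
          eq_of_qdist_eq_zero := fun _ _ _ => rfl } }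
  let s : Cone H :=
    { pt := E
      π :=
        { app := fun j =>
            { toFun := fun _ => x j
              nonexpanding := fun _ _ => (qdist_self (x j)).le }
          naturality := fun _ _ f => hom_ext fun _ => (hx f).symm } }
  exact ⟨(hc.lift s).toFun PUnit.unit, fun j => congr_toFun (hc.fac s j) PUnit.unit⟩

/-- The distance in the apex of a limit cone in `Q`-Met is the supremum of the distances of the
projections: the space with that supremum distance is the apex of a cone, hence maps to the
limit, and its projection from the limit is a section of that map. -/
theorem qdist_le_of_isLimit (hc : IsLimit c) (x y : c.pt.carrier) (q : Q)
    (h : ∀ j, qdist Q ((c.π.app j).toFun x) ((c.π.app j).toFun y) ≤ q) : qdist Q x y ≤ q := by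
  let d : c.pt.carrier → c.pt.carrier → Q := fun x y =>
    ⨆ j, qdist Q ((c.π.app j).toFun x) ((c.π.app j).toFun y)
  have le_d : ∀ x y j, qdist Q ((c.π.app j).toFun x) ((c.π.app j).toFun y) ≤ d x y :=
    fun x y j => le_iSup (fun j => qdist Q ((c.π.app j).toFun x) ((c.π.app j).toFun y)) j
  have d0 : ∀ x, d x x = 0 := fun x =>
    ValueQuantale.eq_zero_of_le (iSup_le fun j => (qdist_self _).le)
  have dc : ∀ x y, d x y = d y x := fun x y => iSup_congr fun j => qdist_comm _ _
  have dt : ∀ x y z, d x z ≤ d x y + d y z := fun x y z => iSup_le fun j =>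
    (qdist_triangle _ _ _).trans (ValueQuantale.add_le_add' (le_d x y j) (le_d y z j))
  let E : QMet.{w, v} Q := ofPseudometric d d0 dc dt
  let m : c.pt ⟶ E :=
    { toFun := ofPseudometricMk d d0 dc dt
      nonexpanding := fun x y => iSup_le fun j => (c.π.app j).nonexpanding x y }
  let s : Cone H :=
    { pt := E
      π :=
        { app := fun j =>
            { toFun := Quotient.lift (c.π.app j).toFun fun a b hab =>
                eq_of_qdist_le_zero (Q := Q) ((le_d a b j).trans (le_of_eq hab))
              nonexpanding := by
                rintro ⟨x⟩ ⟨y⟩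
                exact le_d x y j }
          naturality := fun i j f => hom_ext (by
            rintro ⟨x⟩
            exact congr_toFun (c.w f).symm x) } }
  have hm : m ≫ hc.lift s = 𝟙 _ := hc.hom_ext fun j => by
    rw [Category.assoc, hc.fac, Category.id_comp]
    rfl
  have hx : ∀ x, (hc.lift s).toFun (m.toFun x) = x := fun x => congr_toFun hm x
  rw [← hx x, ← hx y]
  exact ((hc.lift s).nonexpanding _ _).trans (iSup_le h)

end

end QMet

namespace QMetCategory

variable {Q : Type w} [ValueQuantale Q] {K : Type u} [Category.{v} K] [QMetCategory Q K]

theorem qdist_comp_left_le {A B X : K} (g : A ⟶ B) (t t' : B ⟶ X) :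
    qdist Q (g ≫ t) (g ≫ t') ≤ qdist Q t t' :=
  (precomp Q g X).nonexpanding t t'

theorem qdist_comp_right_le {A X Y : K} (t t' : A ⟶ X) (f : X ⟶ Y) :
    qdist Q (t ≫ f) (t' ≫ f) ≤ qdist Q t t' :=
  (postcomp Q A f).nonexpanding t t'

/-! ### Conical colimits, pushouts and copowers -/

section Conical

variable {J : Type v} [SmallCategory J] {H : J ⥤ K} {c : Cocone H}

theorem IsConicalColimit.exists_desc (hc : IsConicalColimit Q c) (s : Cocone H) :
    ∃ t : c.pt ⟶ s.pt, ∀ j, c.ι.app j ≫ t = s.ι.app j := by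
  obtain ⟨h⟩ := hc s.pt
  obtain ⟨t, ht⟩ := QMet.exists_point_of_isLimit h (fun j => s.ι.app j.unop)
    (fun i j f => s.w f.unop)
  exact ⟨t, fun j => ht (op j)⟩

theorem IsConicalColimit.qdist_le (hc : IsConicalColimit Q c) {Z : K} (t t' : c.pt ⟶ Z) (q : Q)
    (h : ∀ j, qdist Q (c.ι.app j ≫ t) (c.ι.app j ≫ t') ≤ q) : qdist Q t t' ≤ q := by
  obtain ⟨hl⟩ := hc Z
  exact QMet.qdist_le_of_isLimit hl t t' q fun j => h j.unop

end Conical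

/-- Pushouts in a category with conical colimits, with the distance of two maps out of a
pushout. -/
theorem exists_conicalPushout (hK : ∀ (J : Type v) [SmallCategory J] (H : J ⥤ K),
      ∃ c : Cocone H, IsConicalColimit Q c) {A B P : K} (i : A ⟶ P) (g : A ⟶ B) :
    ∃ (C : K) (p : P ⟶ C) (b : B ⟶ C), i ≫ p = g ≫ b ∧
      (∀ ⦃Z : K⦄ (w : P ⟶ Z) (v : B ⟶ Z), i ≫ w = g ≫ v → ∃ t : C ⟶ Z, p ≫ t = w ∧ b ≫ t = v) ∧
      ∀ ⦃Z : K⦄ (t t' : C ⟶ Z),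
        qdist Q t t' ≤ qdist Q (p ≫ t) (p ≫ t') ⊔ qdist Q (b ≫ t) (b ≫ t') := by
  obtain ⟨c, hc⟩ := hK (AsSmall.{v} WalkingSpan) (AsSmall.down ⋙ span i g)
  let p : P ⟶ c.pt := c.ι.app (AsSmall.up.obj WalkingSpan.left)
  let b : B ⟶ c.pt := c.ι.app (AsSmall.up.obj WalkingSpan.right)
  let a : A ⟶ c.pt := c.ι.app (AsSmall.up.obj WalkingSpan.zero)
  have hp : a = i ≫ p :=
    (c.w (AsSmall.up.map WalkingSpan.Hom.fst)).symm
  have hb : a = g ≫ b :=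
    (c.w (AsSmall.up.map WalkingSpan.Hom.snd)).symm
  refine ⟨c.pt, p, b, hp.symm.trans hb, fun Z w v h => ?_, fun Z t t' => ?_⟩
  · obtain ⟨t, ht⟩ := hc.exists_desc ((PushoutCocone.mk w v h).whisker AsSmall.down)
    exact ⟨t, ht (AsSmall.up.obj WalkingSpan.left), ht (AsSmall.up.obj WalkingSpan.right)⟩
  · refine hc.qdist_le t t' _ ?_
    rintro ⟨_ | _ | _⟩
    · change qdist Q (a ≫ t) (a ≫ t') ≤ _
      rw [hp, Category.assoc, Category.assoc]
      exact (qdist_comp_left_le i _ _).trans le_sup_left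
    · exact le_sup_left
    · exact le_sup_right

theorem IsCopower.exists_desc {X : QMet.{w, v} Q} {A P : K} {η : X ⟶ hom Q A P}
    (hη : IsCopower Q η) {Z : K} (φ : X ⟶ hom Q A Z) :
    ∃ t : P ⟶ Z, η ≫ postcomp Q A t = φ := by
  have := hη Z
  exact ⟨(inv (copowerComparison Q η Z)).toFun φ,
    QMet.congr_toFun (IsIso.inv_hom_id (copowerComparison Q η Z)) φ⟩

theorem IsCopower.qdist_le {X : QMet.{w, v} Q} {A P : K} {η : X ⟶ hom Q A P}
    (hη : IsCopower Q η) {Z : K} (t t' : P ⟶ Z) (q : Q)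
    (h : ∀ x, qdist Q ((show A ⟶ P from η.toFun x) ≫ t) ((show A ⟶ P from η.toFun x) ≫ t') ≤ q) :
    qdist Q t t' ≤ q := by
  have := hη Z
  have key : ∀ t : P ⟶ Z, (inv (copowerComparison Q η Z)).toFun
      ((copowerComparison Q η Z).toFun t) = t := fun t =>
    QMet.congr_toFun (IsIso.hom_inv_id (copowerComparison Q η Z)) t
  have h1 := (inv (copowerComparison Q η Z)).nonexpanding
    ((copowerComparison Q η Z).toFun t) ((copowerComparison Q η Z).toFun t')
  rw [key, key] at h1
  exact h1.trans (iSup_le h)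

/-! ### Pushouts of squares that commute up to `q` -/

/-- `C`, with `h : A ⟶ C` and `b : B ⟶ C`, is universal among the triangles over `g : A ⟶ B` that
commute up to `q`: the space `K(C, Z)` is, by composition with `h` and `b`, the space of the pairs
`(u, v)` in `K(A, Z) × K(B, Z)` with `d(u, g ≫ v) ≤ q`, with the join metric. -/
structure IsApproxPushout (q : Q) {A B C : K} (g : A ⟶ B) (h : A ⟶ C) (b : B ⟶ C) : Prop where
  dist : qdist Q h (g ≫ b) ≤ q
  exists_desc : ∀ ⦃Z : K⦄ (u : A ⟶ Z) (v : B ⟶ Z), qdist Q u (g ≫ v) ≤ q →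
    ∃ t : C ⟶ Z, h ≫ t = u ∧ b ≫ t = v
  qdist_le : ∀ ⦃Z : K⦄ (t t' : C ⟶ Z),
    qdist Q t t' ≤ qdist Q (h ≫ t) (h ≫ t') ⊔ qdist Q (b ≫ t) (b ≫ t')

/-- The universal triangle commuting up to `q ≠ 0` is the pushout along `g` of one of the two
maps from `A` to the copower `2_q · A`. -/
theorem exists_isApproxPushout (hK : ∀ (J : Type v) [SmallCategory J] (H : J ⥤ K),
      ∃ c : Cocone H, IsConicalColimit Q c)
    (hK' : ∀ (X : QMet.{w, v} Q) (A : K), ∃ (P : K) (η : X ⟶ hom Q A P), IsCopower Q η)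
    {q : Q} (hq : q ≠ 0) {A B : K} (g : A ⟶ B) :
    ∃ (C : K) (h : A ⟶ C) (b : B ⟶ C), IsApproxPushout q g h b := by
  obtain ⟨P, η, hη⟩ := hK' (QMet.two q hq) A
  let i₀ : A ⟶ P := η.toFun ⟨false⟩
  let i₁ : A ⟶ P := η.toFun ⟨true⟩
  have hi : qdist Q i₀ i₁ ≤ q := (η.nonexpanding _ _).trans (QMet.qdist_two hq).le
  obtain ⟨C, p, b, hpb, hC, hC'⟩ := exists_conicalPushout hK i₁ g
  refine ⟨C, i₀ ≫ p, b, ?_, fun Z u v huv => ?_, fun Z t t' => ?_⟩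
  · rw [← hpb]
    exact (qdist_comp_right_le _ _ _).trans hi
  · obtain ⟨w, hw⟩ := hη.exists_desc (QMet.twoDesc (X := hom Q A Z) hq u (g ≫ v) huv)
    have h₀ : i₀ ≫ w = u := QMet.congr_toFun hw ⟨false⟩
    have h₁ : i₁ ≫ w = g ≫ v := QMet.congr_toFun hw ⟨true⟩
    obtain ⟨t, ht, ht'⟩ := hC w v h₁
    exact ⟨t, by rw [Category.assoc, ht, h₀], ht'⟩
  · refine (hC' t t').trans (sup_le (hη.qdist_le _ _ _ ?_) le_sup_right)
    rintro ⟨_ | _⟩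
    · change qdist Q (i₀ ≫ p ≫ t) (i₀ ≫ p ≫ t') ≤ _
      rw [← Category.assoc, ← Category.assoc]
      exact le_sup_left
    · change qdist Q (i₁ ≫ p ≫ t) (i₁ ≫ p ≫ t') ≤ _
      rw [← Category.assoc, ← Category.assoc, hpb, Category.assoc, Category.assoc]
      exact (qdist_comp_left_le g _ _).trans le_sup_right

namespace IsApproxPushout

variable {q : Q} {A B C : K} {g : A ⟶ B} {h : A ⟶ C} {b : B ⟶ C}

theorem hom_ext (hC : IsApproxPushout q g h b) {Z : K} {t t' : C ⟶ Z} (h₁ : h ≫ t = h ≫ t')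
    (h₂ : b ≫ t = b ≫ t') : t = t' := by
  refine eq_of_qdist_le_zero (Q := Q) ((hC.qdist_le t t').trans ?_)
  rw [h₁, h₂, qdist_self, qdist_self, sup_idem]

theorem qdist_comp_le (hC : IsApproxPushout q g h b) {Z : K} (t : C ⟶ Z) :
    qdist Q (h ≫ t) (g ≫ b ≫ t) ≤ q := by
  rw [← Category.assoc g b t]
  exact (qdist_comp_right_le _ _ _).trans hC.dist

/-- For `q ≻ 0` the universal triangle over a map of presentable objects has a presentable apex:
`K(C, -)` is the space of pairs commuting up to `q`, and in a `κ`-filtered colimit both the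
points and the bound `q` are attained at some stage. -/
theorem isPresentableObj (hC : IsApproxPushout q g h b) (hq : TotallyAbove q 0)
    {κ : Cardinal.{v}} [Fact κ.IsRegular]
    (hκ : ∀ (q : Q) (hq : q ≠ 0), TotallyAbove q 0 →
      IsCardinalPresentable (QMet.two.{w, v} q hq) κ)
    (hA : IsPresentableObj Q κ A) (hB : IsPresentableObj Q κ B) : IsPresentableObj Q κ C := by
  refine ⟨fun J _ _ => ⟨fun {H} => ⟨fun {c} hc => ?_⟩⟩⟩
  have := isFiltered_of_isCardinalFiltered J κ
  have : PreservesColimitsOfShape J (covHom Q A) := hA.preservesColimitOfShape J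
  have : PreservesColimitsOfShape J (covHom Q B) := hB.preservesColimitOfShape J
  have hcA := isColimitOfPreserves (covHom Q A) hc
  have hA' := QMet.isMetricColimit_of_isColimit hcA
  have hB' := QMet.isMetricColimit_of_isColimit (isColimitOfPreserves (covHom Q B) hc)
  refine QMet.IsMetricColimit.isColimit ⟨fun (t : C ⟶ c.pt) => ?_,
    fun j (t t' : C ⟶ H.obj j) r hr => ?_⟩
  · obtain ⟨i, (u : A ⟶ H.obj i), (hu : u ≫ c.ι.app i = h ≫ t)⟩ := hA'.surj (h ≫ t)
    obtain ⟨j, (v : B ⟶ H.obj j), (hv : v ≫ c.ι.app j = b ≫ t)⟩ := hB'.surj (b ≫ t)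
    let k := IsFiltered.max i j
    obtain ⟨u', hu'⟩ : ∃ u' : A ⟶ H.obj k, u' ≫ c.ι.app k = h ≫ t :=
      ⟨u ≫ H.map (IsFiltered.leftToMax i j), by rw [Category.assoc, c.w, hu]⟩
    obtain ⟨v', hv'⟩ : ∃ v' : B ⟶ H.obj k, v' ≫ c.ι.app k = b ≫ t :=
      ⟨v ≫ H.map (IsFiltered.rightToMax i j), by rw [Category.assoc, c.w, hv]⟩
    obtain ⟨l, f, (hf : qdist Q (u' ≫ H.map f) ((g ≫ v') ≫ H.map f) ≤ q)⟩ :=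
      QMet.exists_qdist_map_le_of_isColimit hκ hcA hq (j := k) u' (g ≫ v') (by
        change qdist Q (u' ≫ c.ι.app k) ((g ≫ v') ≫ c.ι.app k) ≤ q
        rw [Category.assoc, hu', hv']
        exact hC.qdist_comp_le t)
    rw [Category.assoc] at hf
    obtain ⟨s, hs, hs'⟩ := hC.exists_desc _ _ hf
    refine ⟨l, s, hC.hom_ext ?_ ?_⟩
    · change h ≫ s ≫ c.ι.app l = h ≫ t
      rw [← Category.assoc, hs, Category.assoc, c.w, hu']
    · change b ≫ s ≫ c.ι.app l = b ≫ t
      rw [← Category.assoc, hs', Category.assoc, c.w, hv']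
  · change TotallyAbove r (qdist Q (t ≫ c.ι.app j) (t' ≫ c.ι.app j)) at hr
    obtain ⟨k, f, (hf : qdist Q ((h ≫ t) ≫ H.map f) ((h ≫ t') ≫ H.map f) ≤ r)⟩ :=
      hA'.dist j (h ≫ t) (h ≫ t') r (ValueQuantale.totallyAbove_mono hr (by
        change qdist Q ((h ≫ t) ≫ c.ι.app j) ((h ≫ t') ≫ c.ι.app j) ≤ _
        rw [Category.assoc, Category.assoc]
        exact qdist_comp_left_le h _ _))
    obtain ⟨l, f', (hf' : qdist Q ((b ≫ t) ≫ H.map f') ((b ≫ t') ≫ H.map f') ≤ r)⟩ :=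
      hB'.dist j (b ≫ t) (b ≫ t') r (ValueQuantale.totallyAbove_mono hr (by
        change qdist Q ((b ≫ t) ≫ c.ι.app j) ((b ≫ t') ≫ c.ι.app j) ≤ _
        rw [Category.assoc, Category.assoc]
        exact qdist_comp_left_le b _ _))
    obtain ⟨m, a, a', haa⟩ := IsFiltered.span f f'
    refine ⟨m, f ≫ a, ?_⟩
    change qdist Q (t ≫ H.map (f ≫ a)) (t' ≫ H.map (f ≫ a)) ≤ r
    refine (hC.qdist_le _ _).trans (sup_le ?_ ?_)
    · simp only [H.map_comp, ← Category.assoc] at hf ⊢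
      exact (qdist_comp_right_le _ _ _).trans hf
    · rw [haa]
      simp only [H.map_comp, ← Category.assoc] at hf' ⊢
      exact (qdist_comp_right_le _ _ _).trans hf'

end IsApproxPushout

/-! ### Comparison of the purity notions -/

section Purity

variable {κ : Cardinal.{v}} [Fact κ.IsRegular] {X Y : K} {f : X ⟶ Y}

theorem IsWeaklyPure.isPure (hf : IsWeaklyPure Q κ f) : IsPure Q κ f := by
  rintro A B g hA hB ⟨⟨(u : A ⟶ X), ⟨(w : A ⟶ Y), hw⟩⟩, (huw : u ≫ f = w)⟩ q hq
  obtain ⟨p, hp, hqp⟩ := ValueQuantale.exists_half hq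
  obtain ⟨_, ⟨(v : B ⟶ Y), rfl⟩, hv⟩ := hw p hp
  have huv : qdist Q (u ≫ f) (g ≫ v) ≤ p := by
    rw [huw, qdist_comm]
    exact ValueQuantale.le_of_totallyAbove hv
  obtain ⟨t, ht⟩ := hf p hp g hA hB u v huv
  refine ⟨t, ValueQuantale.totallyAbove_mono hqp (sup_le ht ?_)⟩
  -- The second coordinate of a point of the pullback is the image of the first one under `f`.
  change qdist Q (g ≫ t ≫ f) w ≤ p + p
  rw [← Category.assoc, ← huw]
  exact (qdist_comp_right_le _ _ _).trans ht

theorem IsPure.isBarelyPure (hf : IsPure Q κ f) : IsBarelyPure Q κ f := by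
  rintro A B g hA hB ⟨(u : A ⟶ X), hu⟩ q hq
  obtain ⟨p, hp, hqp⟩ := ValueQuantale.exists_half hq
  obtain ⟨_, ⟨⟨⟨(u' : A ⟶ X), (v : B ⟶ Y)⟩, huv⟩, rfl⟩, hu'⟩ := hu p hp
  obtain ⟨t, ht⟩ := hf g hA hB ⟨(u', (QMet.toClosedImage (precomp Q g Y)).toFun v), huv⟩ p hp
  refine ⟨t, ValueQuantale.totallyAbove_mono hqp ?_⟩
  exact (qdist_triangle (Q := Q) (g ≫ t) u' u).trans (ValueQuantale.add_le_add'
    (le_sup_left.trans (ValueQuantale.le_of_totallyAbove ht))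
    (ValueQuantale.le_of_totallyAbove hu'))

theorem IsBarelyPure.exists_totallyAbove (hf : IsBarelyPure Q κ f) {A B : K} {g : A ⟶ B}
    (hA : IsPresentableObj Q κ A) (hB : IsPresentableObj Q κ B) {u : A ⟶ X} {v : B ⟶ Y}
    (huv : u ≫ f = g ≫ v) {q : Q} (hq : TotallyAbove q 0) :
    ∃ t : B ⟶ X, TotallyAbove q (qdist Q (g ≫ t) u) :=
  hf g hA hB ((QMet.toClosedImage (arrowProj Q g f)).toFun ⟨(u, v), huv⟩) q hq

/-- A square from `g` to `f` commuting up to `q` is a commutative square from `h` to `f`, where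
`h : A ⟶ C` is the leg of the universal triangle over `g` commuting up to `q`. An approximate
filler for `h` restricts along `B ⟶ C` to one for `g`, at the cost of another `q`. -/
theorem IsBarelyPure.isWeaklyPure (hf : IsBarelyPure Q κ f)
    (hκ : ∀ (q : Q) (hq : q ≠ 0), TotallyAbove q 0 →
      IsCardinalPresentable (QMet.two.{w, v} q hq) κ)
    (hK : IsLocallyPresentable Q K κ) : IsWeaklyPure Q κ f := by
  intro q hq A B g hA hB u v huv
  by_cases hq0 : q = 0
  · obtain ⟨t, ht⟩ := hf.exists_totallyAbove hA hB
      (eq_of_qdist_le_zero (Q := Q) (huv.trans hq0.le)) hq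
    exact ⟨t, (ValueQuantale.le_of_totallyAbove ht).trans (ValueQuantale.le_add_right' q q)⟩
  · obtain ⟨C, h, b, hC⟩ := exists_isApproxPushout hK.conicalColimits hK.copowers hq0 g
    obtain ⟨s, hs, -⟩ := hC.exists_desc _ _ huv
    obtain ⟨t, ht⟩ := hf.exists_totallyAbove hA (hC.isPresentableObj hq hκ hA hB) hs.symm hq
    refine ⟨b ≫ t, (qdist_triangle (Q := Q) _ (h ≫ t) _).trans (ValueQuantale.add_le_add' ?_
      (ValueQuantale.le_of_totallyAbove ht))⟩
    rw [qdist_comm]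
    exact hC.qdist_comp_le t

end Purity

end QMetCategory

theorem mainTheorem7 (Q : Type w) [ValueQuantale Q] (κ : Cardinal.{v}) [Fact κ.IsRegular]
    (hκ : ∀ (q : Q) (hq : q ≠ 0), TotallyAbove q 0 →
      IsCardinalPresentable (QMet.two.{w, v} q hq) κ)
    (K : Type u) [Category.{v} K] [QMetCategory Q K]
    (hK : QMetCategory.IsLocallyPresentable Q K κ)
    {X Y : K} (f : X ⟶ Y) :
    [QMetCategory.IsWeaklyPure Q κ f, QMetCategory.IsPure Q κ f,
      QMetCategory.IsBarelyPure Q κ f].TFAE := by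
  tfae_have 1 → 2 := fun hf => hf.isPure
  tfae_have 2 → 3 := fun hf => hf.isBarelyPure
  tfae_have 3 → 1 := fun hf => hf.isWeaklyPure hκ hK
  tfae_finish
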